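/- **Setting.** Let $E,F$ be separable real Banach spaces, $(\Omega,\mathcal A,\mu)$ a probability space, and let $X:\Omega\to E$, $Y:\Omega\to F$ be random variables (measurable with respect to the Borel $\sigma$-algebras) which are jointly Gaussian, i.e. $e'(X)+f'(Y)$ is a (possibly degenerate) real Gaussian random variable for all $e'\in E'$, $f'\in F'$, and which satisfy $\mathbb E(X)=0$ and $\mathbb E(Y)=0$. Let $\sigma(Y)$ be the smallest $\sigma$-algebra for which all $f'(Y)$, $f'\in F'$, are measurable, and let $Z:=\mathbb E(X\mid\sigma(Y))$ be the (Bochner) conditional expectation; then $X,Y,Z$ are square Bochner integrable. For a square integrable random variable $U$ with values in a Banach space $B$, let $G_U$ be the closure in $L^2(\mu)=L^2(\mu;\mathbb R)$ of $\{b'(U): b'\in B'\}$, and let $$W_U:=\Bigl\{b\in B:\ b=\int_\Omega gU\,d\mu \text{ for some } g\in G_U\Bigr\},\qquad \|b\|_{W_U}:=\inf\Bigl\{\|g\|_{L^2(\mu)}:\ g\in G_U,\ b=\int_\Omega gU\,d\mu\Bigr\},$$ which is a Hilbert space. Let $\hat V_U:L^2(\mu)\to W_U$ be the bounded operator $\hat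 V_U g:=\int_\Omega gU\,d\mu$, and let $\hat V_U^*:W_U\to L^2(\mu)$ be its Hilbert space adjoint. Define $$M_W:=\hat V_Z\hat V_Y^*:\ W_Y\to W_Z .$$ **Lemma.** Assume that $W_Y$ is dense in $F$ and that there is a constant $C>0$ such that $$\|M_W w\|_E\le C\,\|w\|_F\qquad\text{for all } w\in W_Y .$$ Then there exists a bounded linear operator $M:F\to E$ such that $M|_{W_Y}=M_W$ and $MY=Z$ $\mu$-almost everywhere. -/

import Mathlib

open MeasureTheory ProbabilityTheory
open scoped ENNReal

/-! Real Banach spaces throughout; `μ` is a measure on `Ω`.  The spaces `G_X`, `W_X` and the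
operators `V_X` are defined for square Bochner integrable random variables, that is, for elements
`X` of the Bochner space `L²(μ; E)`. -/

/-- The Gaussian Hilbert space `G_X`: the closure in `L²(μ)` of `{e'(X) | e' ∈ E'}`. -/
noncomputable def gaussianHilbert {Ω E : Type*} [MeasurableSpace Ω] {μ : Measure Ω}
    [NormedAddCommGroup E] [NormedSpace ℝ E] (X : Lp E 2 μ) : Submodule ℝ (Lp ℝ 2 μ) :=
  Submodule.topologicalClosure
    { carrier := {g | ∃ e' : StrongDual ℝ E, g = e'.compLp X}
      zero_mem' := ⟨0, by
        refine (Lp.eq_zero_iff_ae_eq_zero.2 ?_).symm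
        filter_upwards [ContinuousLinearMap.coeFn_compLp (0 : StrongDual ℝ E) X] with ω h
        simpa using h⟩
      add_mem' := by
        rintro _ _ ⟨a, rfl⟩ ⟨b, rfl⟩
        exact ⟨a + b, (ContinuousLinearMap.add_compLp a b X).symm⟩
      smul_mem' := by
        rintro c _ ⟨a, rfl⟩
        exact ⟨c • a, (ContinuousLinearMap.smul_compLp c a X).symm⟩ }

theorem integrable_smul_of_L2 {Ω E : Type*} [MeasurableSpace Ω] {μ : Measure Ω}
    [NormedAddCommGroup E] [NormedSpace ℝ E] (X : Lp E 2 μ) (g : Lp ℝ 2 μ) :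
    Integrable (fun ω => g ω • X ω) μ :=
  memLp_one_iff_integrable.1 ((Lp.memLp X).smul (Lp.memLp g))

/-- The map `L²(μ) → E`, `g ↦ ∫ g X dμ`, as a linear map. -/
noncomputable def bochnerPairing {Ω E : Type*} [MeasurableSpace Ω] {μ : Measure Ω}
    [NormedAddCommGroup E] [NormedSpace ℝ E] (X : Lp E 2 μ) : Lp ℝ 2 μ →ₗ[ℝ] E where
  toFun g := ∫ ω, g ω • X ω ∂μ
  map_add' g h := by
    rw [← integral_add (integrable_smul_of_L2 X g) (integrable_smul_of_L2 X h)]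
    refine integral_congr_ae ?_
    filter_upwards [Lp.coeFn_add g h] with ω hω
    rw [hω, Pi.add_apply, add_smul]
  map_smul' c g := by
    rw [RingHom.id_apply, ← integral_smul]
    refine integral_congr_ae ?_
    filter_upwards [Lp.coeFn_smul c g] with ω hω
    rw [hω, Pi.smul_apply, smul_eq_mul, mul_smul]

theorem dual_bochnerPairing {Ω E : Type*} [MeasurableSpace Ω] {μ : Measure Ω}
    [NormedAddCommGroup E] [NormedSpace ℝ E] [CompleteSpace E] (X : Lp E 2 μ)
    (e' : StrongDual ℝ E) (g : Lp ℝ 2 μ) :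
    e' (bochnerPairing X g) = inner ℝ (e'.compLp X) g := by
  rw [L2.inner_def]
  change e' (∫ ω, g ω • X ω ∂μ) = _
  rw [← ContinuousLinearMap.integral_comp_comm e' (integrable_smul_of_L2 X g)]
  refine integral_congr_ae ?_
  filter_upwards [ContinuousLinearMap.coeFn_compLp e' X] with ω hω
  simp [hω]

theorem mem_gaussianHilbert_orthogonal {Ω E : Type*} [MeasurableSpace Ω] {μ : Measure Ω}
    [NormedAddCommGroup E] [NormedSpace ℝ E] [CompleteSpace E] (X : Lp E 2 μ) (g : Lp ℝ 2 μ) :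
    g ∈ (gaussianHilbert X)ᗮ ↔ bochnerPairing X g = 0 := by
  rw [gaussianHilbert, Submodule.orthogonal_closure, Submodule.mem_orthogonal]
  constructor
  · intro h
    refine SeparatingDual.eq_zero_of_forall_dual_eq_zero (R := ℝ) fun e' => ?_
    rw [dual_bochnerPairing]
    exact h _ ⟨e', rfl⟩
  · rintro h _ ⟨e', rfl⟩
    rw [← dual_bochnerPairing, h, map_zero]

/-- The abstract Wiener space `W_X` as a linear subspace of `E`:
all `e ∈ E` of the form `e = ∫ g X dμ` with `g ∈ G_X`. -/
noncomputable def wienerSubmodule {Ω E : Type*} [MeasurableSpace Ω] {μ : Measure Ω}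
    [NormedAddCommGroup E] [NormedSpace ℝ E] (X : Lp E 2 μ) : Submodule ℝ E :=
  (gaussianHilbert X).map (bochnerPairing X)

theorem mem_wienerSubmodule_iff {Ω E : Type*} [MeasurableSpace Ω] {μ : Measure Ω}
    [NormedAddCommGroup E] [NormedSpace ℝ E] (X : Lp E 2 μ) (e : E) :
    e ∈ wienerSubmodule X ↔ ∃ g ∈ gaussianHilbert X, e = ∫ ω, g ω • X ω ∂μ :=
  ⟨fun ⟨g, hg, h⟩ => ⟨g, hg, h.symm⟩, fun ⟨g, hg, h⟩ => ⟨g, hg, h.symm⟩⟩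

/-- The abstract Wiener space `W_X` as a type of its own, because it carries its own Hilbert space
norm and not the one of `E`. -/
def WienerSpace {Ω E : Type*} [MeasurableSpace Ω] {μ : Measure Ω}
    [NormedAddCommGroup E] [NormedSpace ℝ E] (X : Lp E 2 μ) : Type _ :=
  ↥(wienerSubmodule X)

namespace WienerSpace

section algebra

variable {Ω E : Type*} [MeasurableSpace Ω] {μ : Measure Ω}
  [NormedAddCommGroup E] [NormedSpace ℝ E] (X : Lp E 2 μ)

noncomputable instance : AddCommGroup (WienerSpace X) :=
  inferInstanceAs (AddCommGroup ↥(wienerSubmodule X))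

noncomputable instance : Module ℝ (WienerSpace X) :=
  inferInstanceAs (Module ℝ ↥(wienerSubmodule X))

/-- The inclusion `W_X → E`. -/
noncomputable def incl : WienerSpace X →ₗ[ℝ] E := (wienerSubmodule X).subtype

theorem incl_injective : Function.Injective (incl X) := Subtype.val_injective

/-- The norm `‖e‖ = inf {‖g‖ | g ∈ G_X, e = ∫ g X dμ}` of `W_X`. -/
noncomputable instance : Norm (WienerSpace X) :=
  ⟨fun e => sInf {r | ∃ g ∈ gaussianHilbert X, incl X e = ∫ ω, g ω • X ω ∂μ ∧ r = ‖g‖}⟩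

/-- The operator `V_X : G_X → W_X`, `V_X g = ∫ g X dμ`. -/
noncomputable def V : gaussianHilbert X →ₗ[ℝ] WienerSpace X :=
  (bochnerPairing X).restrict (fun g hg => ⟨g, hg, rfl⟩ :
    ∀ g ∈ gaussianHilbert X, bochnerPairing X g ∈ wienerSubmodule X)

theorem incl_V (g : gaussianHilbert X) :
    incl X (V X g) = ∫ ω, (g : Lp ℝ 2 μ) ω • X ω ∂μ := rfl

theorem V_surjective : Function.Surjective (V X) := by
  rintro ⟨e, g, hg, rfl⟩
  exact ⟨⟨g, hg⟩, rfl⟩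

end algebra

section hilbert

variable {Ω E : Type*} [MeasurableSpace Ω] {μ : Measure Ω}
  [NormedAddCommGroup E] [NormedSpace ℝ E] [CompleteSpace E] (X : Lp E 2 μ)

theorem V_injective : Function.Injective (V X) := by
  rw [injective_iff_map_eq_zero]
  intro g hg
  have h : bochnerPairing X (g : Lp ℝ 2 μ) = 0 := by
    have := congrArg (incl X) hg
    rwa [map_zero] at this
  have h2 := (mem_gaussianHilbert_orthogonal X (g : Lp ℝ 2 μ)).2 h
  have h3 := (Submodule.mem_orthogonal _ _).1 h2 _ g.2
  exact Subtype.ext (inner_self_eq_zero.1 h3)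

/-- `V_X` as a linear bijection. -/
noncomputable def VEquiv : gaussianHilbert X ≃ₗ[ℝ] WienerSpace X :=
  LinearEquiv.ofBijective (V X) ⟨V_injective X, V_surjective X⟩

theorem norm_V (g : gaussianHilbert X) : ‖V X g‖ = ‖g‖ := by
  have : {r | ∃ h ∈ gaussianHilbert X,
      incl X (V X g) = ∫ ω, h ω • X ω ∂μ ∧ r = ‖h‖} = {‖g‖} := by
    ext r
    constructor
    · rintro ⟨h, hh, he, rfl⟩
      have : g = ⟨h, hh⟩ := V_injective X (incl_injective X he)
      rw [this]
      rfl
    · rintro rfl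
      exact ⟨g, g.2, rfl, rfl⟩
  change sInf _ = _
  rw [this, csInf_singleton]

theorem norm_eq (e : WienerSpace X) : ‖e‖ = ‖(VEquiv X).symm e‖ := by
  conv_lhs => rw [← (VEquiv X).apply_symm_apply e]
  exact norm_V X _

/-- The norm of `W_X` is a norm. -/
noncomputable instance : NormedAddCommGroup (WienerSpace X) :=
  AddGroupNorm.toNormedAddCommGroup
    { toFun := fun e => ‖e‖
      map_zero' := by rw [norm_eq, map_zero, norm_zero]
      add_le' := fun a b => by
        rw [norm_eq, norm_eq X a, norm_eq X b, map_add]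
        exact norm_add_le _ _
      neg' := fun a => by rw [norm_eq, norm_eq X a, map_neg, norm_neg]
      eq_zero_of_map_eq_zero' := fun a h => by
        rw [norm_eq, norm_eq_zero] at h
        exact (LinearEquiv.map_eq_zero_iff _).1 h }

/-- The inner product that induces the norm of `W_X`. -/
noncomputable instance : InnerProductSpace ℝ (WienerSpace X) where
  norm_smul_le c a := by
    rw [norm_eq, norm_eq X a, map_smul, norm_smul]
  inner a b := inner ℝ ((VEquiv X).symm a) ((VEquiv X).symm b)
  norm_sq_eq_re_inner a := by
    rw [norm_eq]
    exact norm_sq_eq_re_inner (𝕜 := ℝ) _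
  conj_inner_symm a b := inner_conj_symm _ _
  add_left a b c := by rw [map_add, inner_add_left]
  smul_left a b c := by 
    rw [map_smul]
    exact inner_smul_left (𝕜 := ℝ) (E := gaussianHilbert X) _ _ c

/-- `V_X` as an isometric isomorphism. -/
noncomputable def VIsometry : gaussianHilbert X ≃ₗᵢ[ℝ] WienerSpace X :=
  { VEquiv X with norm_map' := norm_V X }

instance : CompleteSpace (gaussianHilbert X) :=
  (Submodule.isClosed_topologicalClosure _).completeSpace_coe

instance : CompleteSpace (WienerSpace X) :=
  (VIsometry X).toIsometryEquiv.completeSpace_iff.1 inferInstance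

theorem bochnerPairing_starProjection (g : Lp ℝ 2 μ) :
    bochnerPairing X ((gaussianHilbert X).starProjection g) = bochnerPairing X g := by
  have h := (mem_gaussianHilbert_orthogonal X _).1
    ((gaussianHilbert X).sub_starProjection_mem_orthogonal g)
  rw [map_sub, sub_eq_zero] at h
  exact h.symm

theorem bochnerPairing_mem (g : Lp ℝ 2 μ) : bochnerPairing X g ∈ wienerSubmodule X :=
  ⟨_, (gaussianHilbert X).starProjection_apply_mem g, bochnerPairing_starProjection X g⟩

/-- `V̂_X` as a linear map. -/
noncomputable def VHatLin : Lp ℝ 2 μ →ₗ[ℝ] WienerSpace X :=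
  (bochnerPairing X).codRestrict (wienerSubmodule X) (bochnerPairing_mem X)

theorem norm_VHatLin_le (g : Lp ℝ 2 μ) : ‖VHatLin X g‖ ≤ 1 * ‖g‖ := by
  have h : VHatLin X g = V X ((gaussianHilbert X).orthogonalProjectionOnto g) :=
    incl_injective X (bochnerPairing_starProjection X g).symm
  rw [h, norm_V, one_mul]
  exact (gaussianHilbert X).norm_orthogonalProjectionOnto_apply_le g

/-- The bounded operator `V̂_X : L²(μ) → W_X`, `V̂_X g = ∫ g X dμ`. -/
noncomputable def VHat : Lp ℝ 2 μ →L[ℝ] WienerSpace X :=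
  (VHatLin X).mkContinuous 1 (norm_VHatLin_le X)

theorem incl_VHat (g : Lp ℝ 2 μ) : incl X (VHat X g) = ∫ ω, g ω • X ω ∂μ := rfl

end hilbert

end WienerSpace

/-- The operator `M_W = V̂_Z V̂_Y^* : W_Y → W_Z`, where `V̂_Y^*` is the Hilbert space adjoint
of `V̂_Y : L²(μ) → W_Y`. -/
noncomputable def wienerM {Ω E F : Type*} [MeasurableSpace Ω] {μ : Measure Ω}
    [NormedAddCommGroup E] [NormedSpace ℝ E] [CompleteSpace E]
    [NormedAddCommGroup F] [NormedSpace ℝ F] [CompleteSpace F]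
    (Y : Lp F 2 μ) (Z : Lp E 2 μ) : WienerSpace Y →L[ℝ] WienerSpace Z :=
  (WienerSpace.VHat Z).comp (ContinuousLinearMap.adjoint (WienerSpace.VHat Y))

/-- The `σ`-algebra `σ(Y)`: the smallest one for which all `f'(Y)`, `f' ∈ F'`, are measurable. -/
@[reducible] def weakSigma {Ω F : Type*} [NormedAddCommGroup F] [NormedSpace ℝ F] (Y : Ω → F) :
    MeasurableSpace Ω :=
  ⨆ f' : StrongDual ℝ F, MeasurableSpace.comap (fun ω => f' (Y ω)) (borel ℝ)

/-- `X` and `Y` are random variables, jointly Gaussian and centered. -/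
structure CenteredJointlyGaussian {Ω E F : Type*} [MeasurableSpace Ω]
    [NormedAddCommGroup E] [NormedSpace ℝ E] [MeasurableSpace E]
    [NormedAddCommGroup F] [NormedSpace ℝ F] [MeasurableSpace F]
    (X : Ω → E) (Y : Ω → F) (μ : Measure Ω) : Prop where
  measurable_fst : Measurable X
  measurable_snd : Measurable Y
  jointlyGaussian : HasGaussianLaw (fun ω => (X ω, Y ω)) μ
  centered_fst : ∫ ω, X ω ∂μ = 0
  centered_snd : ∫ ω, Y ω ∂μ = 0

/-- The conditional expectation `Z = 𝔼(X|Y) = 𝔼(X|σ(Y))`. -/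
noncomputable def condExpGiven {Ω E F : Type*} [MeasurableSpace Ω]
    [NormedAddCommGroup E] [NormedSpace ℝ E] [CompleteSpace E]
    [NormedAddCommGroup F] [NormedSpace ℝ F]
    (X : Ω → E) (Y : Ω → F) (μ : Measure Ω) : Ω → E :=
  μ[X | weakSigma Y]

theorem memLp_two_condExp {Ω E : Type*} {m mΩ : MeasurableSpace Ω} {μ : Measure Ω}
    [IsFiniteMeasure μ] [NormedAddCommGroup E] [NormedSpace ℝ E] [CompleteSpace E]
    {X : Ω → E} (hX : MemLp X 2 μ) : MemLp (μ[X | m]) 2 μ := by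
  by_cases hm : m ≤ mΩ
  swap
  · rw [condExp_of_not_le hm]
    exact MemLp.zero
  have hmeas : AEStronglyMeasurable (μ[X | m]) μ :=
    (stronglyMeasurable_condExp.mono hm).aestronglyMeasurable
  have hcvx : ConvexOn ℝ Set.univ (fun x : E => ‖x‖ ^ 2) :=
    (convexOn_norm convex_univ).pow (fun _ _ => norm_nonneg _) 2
  have hsq : Integrable ((fun x : E => ‖x‖ ^ 2) ∘ X) μ := hX.integrable_norm_pow two_ne_zero
  have hcont : Continuous (fun x : E => ‖x‖ ^ 2) := by fun_prop
  have hJ := hcvx.map_condExp_le hm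
    (hcont.lowerSemicontinuous.lowerSemicontinuousOn _)
    (Filter.Eventually.of_forall fun _ => Set.mem_univ _) isClosed_univ
    (hX.integrable one_le_two) hsq
  refine (memLp_two_iff_integrable_sq_norm hmeas).2 ?_
  refine Integrable.mono' (integrable_condExp (m := m)
    (f := (fun x : E => ‖x‖ ^ 2) ∘ X)) (hmeas.norm.pow 2) ?_
  filter_upwards [hJ] with ω hω
  rw [Real.norm_of_nonneg (by positivity)]
  exact hω

namespace CenteredJointlyGaussian

theorem memLp_fst {Ω E F : Type*} [MeasurableSpace Ω] {μ : Measure Ω}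
    [NormedAddCommGroup E] [NormedSpace ℝ E] [CompleteSpace E]
    [TopologicalSpace.SeparableSpace E] [MeasurableSpace E] [BorelSpace E]
    [NormedAddCommGroup F] [NormedSpace ℝ F] [MeasurableSpace F]
    {X : Ω → E} {Y : Ω → F} (h : CenteredJointlyGaussian X Y μ) : MemLp X 2 μ := by
  have := UniformSpace.secondCountable_of_separable E
  have hX : HasGaussianLaw X μ := h.jointlyGaussian.fst
  exact hX.memLp_two

theorem memLp_condExpGiven {Ω E F : Type*} [MeasurableSpace Ω] {μ : Measure Ω}
    [IsProbabilityMeasure μ] [NormedAddCommGroup E] [NormedSpace ℝ E] [CompleteSpace E]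
    [TopologicalSpace.SeparableSpace E] [MeasurableSpace E] [BorelSpace E]
    [NormedAddCommGroup F] [NormedSpace ℝ F] [MeasurableSpace F]
    {X : Ω → E} {Y : Ω → F} (h : CenteredJointlyGaussian X Y μ) :
    MemLp (condExpGiven X Y μ) 2 μ :=
  memLp_two_condExp h.memLp_fst

theorem memLp_snd {Ω E F : Type*} [MeasurableSpace Ω] {μ : Measure Ω}
    [NormedAddCommGroup E] [NormedSpace ℝ E] [MeasurableSpace E]
    [NormedAddCommGroup F] [NormedSpace ℝ F] [CompleteSpace F]
    [TopologicalSpace.SeparableSpace F] [MeasurableSpace F] [BorelSpace F]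
    {X : Ω → E} {Y : Ω → F} (h : CenteredJointlyGaussian X Y μ) : MemLp Y 2 μ := by
  have := UniformSpace.secondCountable_of_separable F
  have hY : HasGaussianLaw Y μ := h.jointlyGaussian.snd
  exact hY.memLp_two

variable {Ω E F : Type*} [MeasurableSpace Ω] {μ : Measure Ω} [IsProbabilityMeasure μ]
  [NormedAddCommGroup E] [NormedSpace ℝ E] [CompleteSpace E] [TopologicalSpace.SeparableSpace E]
  [MeasurableSpace E] [BorelSpace E]
  [NormedAddCommGroup F] [NormedSpace ℝ F] [CompleteSpace F] [TopologicalSpace.SeparableSpace F]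
  [MeasurableSpace F] [BorelSpace F] {X : Ω → E} {Y : Ω → F}

/-- `Y` as an element of `L²(μ; F)`. -/
noncomputable def Y2 (h : CenteredJointlyGaussian X Y μ) : Lp F 2 μ := h.memLp_snd.toLp Y

/-- `Z = 𝔼(X|Y)` as an element of `L²(μ; E)`. -/
noncomputable def Z2 (h : CenteredJointlyGaussian X Y μ) : Lp E 2 μ :=
  h.memLp_condExpGiven.toLp (condExpGiven X Y μ)

/-- The operator `M_W : W_Y → W_Z` of the pair `(X, Y)`. -/
noncomputable def M_W (h : CenteredJointlyGaussian X Y μ) :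
    WienerSpace h.Y2 →L[ℝ] WienerSpace h.Z2 :=
  wienerM h.Y2 h.Z2

end CenteredJointlyGaussian

/-! The density and the bound extend `M_W` to a bounded operator `M` on all of `F`; the real claim
is that `MY = Z`. For `g ∈ G_Y` the adjoint of `V̂_Y` takes `V_Y g` back to `g`, so `M (∫ g Y) = M_W
(V_Y g) = V̂_Z g`, that is, `∫ g MY = ∫ g Z` (`incl_wienerM_V`, `bochnerPairing_compLp`). Such
pairings determine an `L²` vector whose weak components all lie in `G_Y`
(`eq_of_bochnerPairing_eq`). For `MY` this is clear, since `e' ∘ M ∈ F'`.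

For `Z` it is where Gaussianity enters (`compLp_Z2`). Let `p` be the orthogonal projection of
`e'(X)` onto `G_Y`. The residual `e'(X) - p` is jointly Gaussian with `Y` and uncorrelated with
every `f'(Y)`, hence independent of `Y`; being centered, it has conditional expectation zero, so
`e'(Z) = p`. As `p` is only an `L²` limit of variables `f'(Y)`, joint Gaussianity with it requires
Gaussian laws to be closed in `L²` (`isClosed_hasGaussianLaw_L2`). -/

set_option linter.unusedSectionVars false

/-! ### Gaussian laws under `L²` limits. -/

section GaussianLimits

variable {Ω : Type*} [MeasurableSpace Ω] {μ : Measure Ω} [IsProbabilityMeasure μ]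

theorem continuous_integral_L2 : Continuous fun g : Lp ℝ 2 μ => ∫ ω, g ω ∂μ := by
  have h : ∀ g : Lp ℝ 2 μ, ∫ ω, g ω ∂μ = inner ℝ (indicatorConstLp 2 MeasurableSet.univ
      (measure_ne_top μ _) (1 : ℝ)) g := fun g => by
    rw [L2.inner_indicatorConstLp_one, setIntegral_univ]
  simp_rw [h]
  fun_prop

theorem continuous_variance_L2 : Continuous fun g : Lp ℝ 2 μ => Var[g; μ] := by
  have h : ∀ g : Lp ℝ 2 μ, Var[g; μ] = ‖g‖ ^ 2 - (∫ ω, g ω ∂μ) ^ 2 := fun g => by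
    rw [variance_eq_sub (Lp.memLp g), ← real_inner_self_eq_norm_sq, L2.inner_def]
    simp [pow_two]
  simp_rw [h]
  exact (continuous_norm.pow 2).sub (continuous_integral_L2.pow 2)

/-- Convergence in `L²` implies convergence in measure, hence in distribution. -/
theorem continuous_charFun_map_L2 (t : ℝ) :
    Continuous fun g : Lp ℝ 2 μ => charFun (μ.map g) t := by
  refine continuous_iff_seqContinuous.2 fun u g hu => ?_
  have h := (tendstoInMeasure_of_tendsto_Lp hu).tendstoInDistribution
    fun n => (Lp.aestronglyMeasurable (u n)).aemeasurable
  exact ProbabilityMeasure.tendsto_iff_tendsto_charFun.1 h.tendsto t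

/-- Gaussian random variables form a closed subset of `L²`. -/
theorem isClosed_hasGaussianLaw_L2 : IsClosed {g : Lp ℝ 2 μ | HasGaussianLaw g μ} := by
  -- For each fixed `t`, Gaussianity is an equation between two continuous functions of `g`, because
  -- mean and variance are continuous on `L²`.
  have h : ∀ g : Lp ℝ 2 μ, HasGaussianLaw g μ ↔ ∀ t : ℝ, charFun (μ.map g) t =
      Complex.exp ((t * ∫ ω, g ω ∂μ : ℝ) * Complex.I - (t ^ 2 * Var[g; μ] : ℝ) / 2) := fun g => by
    rw [hasGaussianLaw_iff_charFun_map_eq (Lp.aestronglyMeasurable g).aemeasurable]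
    refine forall_congr' fun t => ?_
    simp only [RCLike.inner_apply, conj_trivial, mul_comm _ t, integral_const_mul,
      variance_const_mul]
  simp_rw [h, Set.ofPred_forall]
  refine isClosed_iInter fun t => isClosed_eq (continuous_charFun_map_L2 t) ?_
  have h1 := continuous_integral_L2 (μ := μ)
  have h2 := continuous_variance_L2 (μ := μ)
  fun_prop

end GaussianLimits

/-! ### Pairings with `G_X` and the action of `M_W`. -/

theorem compLp_mem_gaussianHilbert {Ω E : Type*} [MeasurableSpace Ω] {μ : Measure Ω}
    [NormedAddCommGroup E] [NormedSpace ℝ E] (X : Lp E 2 μ) (e' : StrongDual ℝ E) :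
    e'.compLp X ∈ gaussianHilbert X :=
  Submodule.le_topologicalClosure _ ⟨e', rfl⟩

theorem gaussianHilbert_subset {Ω E : Type*} [MeasurableSpace Ω] {μ : Measure Ω}
    [NormedAddCommGroup E] [NormedSpace ℝ E] (X : Lp E 2 μ) {s : Set (Lp ℝ 2 μ)}
    (hs : IsClosed s) (h : ∀ e' : StrongDual ℝ E, e'.compLp X ∈ s) :
    (gaussianHilbert X : Set (Lp ℝ 2 μ)) ⊆ s :=
  closure_minimal (by rintro _ ⟨e', rfl⟩; exact h e') hs

/-- `V̂_X` is the orthogonal projection onto `G_X` followed by the isometry `V_X`, so its adjoint is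
the inverse of `V_X` followed by the inclusion. -/
theorem adjoint_VHat_V {Ω E : Type*} [MeasurableSpace Ω] {μ : Measure Ω}
    [NormedAddCommGroup E] [NormedSpace ℝ E] [CompleteSpace E] (X : Lp E 2 μ)
    (g : gaussianHilbert X) :
    ContinuousLinearMap.adjoint (WienerSpace.VHat X) (WienerSpace.V X g) = g := by
  refine ext_inner_right ℝ fun k => ?_
  rw [ContinuousLinearMap.adjoint_inner_left]
  have hk : WienerSpace.VHat X k =
      WienerSpace.V X ((gaussianHilbert X).orthogonalProjectionOnto k) :=
    WienerSpace.incl_injective X (WienerSpace.bochnerPairing_starProjection X k).symm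
  rw [hk]
  refine ((WienerSpace.VIsometry X).inner_map_map g _).trans ?_
  exact (gaussianHilbert X).inner_orthogonalProjectionOnto_eq_of_mem_left g k

theorem incl_wienerM_V {Ω E F : Type*} [MeasurableSpace Ω] {μ : Measure Ω}
    [NormedAddCommGroup E] [NormedSpace ℝ E] [CompleteSpace E]
    [NormedAddCommGroup F] [NormedSpace ℝ F] [CompleteSpace F]
    (Y : Lp F 2 μ) (Z : Lp E 2 μ) (g : gaussianHilbert Y) :
    WienerSpace.incl Z (wienerM Y Z (WienerSpace.V Y g)) = bochnerPairing Z g := by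
  rw [wienerM, ContinuousLinearMap.comp_apply, adjoint_VHat_V]
  rfl

theorem bochnerPairing_compLp {Ω E F : Type*} [MeasurableSpace Ω] {μ : Measure Ω}
    [NormedAddCommGroup E] [NormedSpace ℝ E] [CompleteSpace E]
    [NormedAddCommGroup F] [NormedSpace ℝ F] [CompleteSpace F]
    (M : F →L[ℝ] E) (Y : Lp F 2 μ) (g : Lp ℝ 2 μ) :
    bochnerPairing (M.compLp Y) g = M (bochnerPairing Y g) := by
  change ∫ ω, g ω • M.compLp Y ω ∂μ = M (∫ ω, g ω • Y ω ∂μ)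
  rw [← M.integral_comp_comm (integrable_smul_of_L2 Y g)]
  refine integral_congr_ae ?_
  filter_upwards [M.coeFn_compLp Y] with ω hω
  rw [hω, map_smul]

theorem compLp_compLp {Ω E F G : Type*} [MeasurableSpace Ω] {μ : Measure Ω}
    [NormedAddCommGroup E] [NormedSpace ℝ E] [NormedAddCommGroup F] [NormedSpace ℝ F]
    [NormedAddCommGroup G] [NormedSpace ℝ G] (L : E →L[ℝ] G) (M : F →L[ℝ] E) (Y : Lp F 2 μ) :
    L.compLp (M.compLp Y) = (L.comp M).compLp Y := by
  refine Lp.ext ?_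
  filter_upwards [L.coeFn_compLp (M.compLp Y), M.coeFn_compLp Y, (L.comp M).coeFn_compLp Y]
    with ω h1 h2 h3
  rw [h1, h2, h3, ContinuousLinearMap.comp_apply]

/-- An element of `L²(μ; E)` is determined by its pairings with a subspace of `L²(μ)` that
contains all its weak components. -/
theorem eq_of_bochnerPairing_eq {Ω E : Type*} [MeasurableSpace Ω] {μ : Measure Ω}
    [NormedAddCommGroup E] [NormedSpace ℝ E] [CompleteSpace E] [SecondCountableTopology E]
    (U V : Lp E 2 μ) (G : Submodule ℝ (Lp ℝ 2 μ))
    (hU : ∀ e' : StrongDual ℝ E, e'.compLp U ∈ G) (hV : ∀ e' : StrongDual ℝ E, e'.compLp V ∈ G)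
    (h : ∀ g ∈ G, bochnerPairing U g = bochnerPairing V g) : U = V := by
  have hw : ∀ e' : StrongDual ℝ E, e'.compLp U = e'.compLp V := fun e' => by
    -- The difference `e'(U) - e'(V)` is itself in `G`; pairing `U` and `V` with it shows that it is
    -- orthogonal to itself.
    refine sub_eq_zero.1 (inner_self_eq_zero (𝕜 := ℝ).1 ?_)
    rw [inner_sub_left, ← dual_bochnerPairing, ← dual_bochnerPairing,
      h _ (G.sub_mem (hU e') (hV e')), sub_self]
  -- The exceptional null set depends on `e'`; second countability of `E` removes this dependence.
  have h0 : (fun ω => U ω - V ω) =ᵐ[μ] 0 := ae_eq_zero_of_forall_dual ℝ fun e' => by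
    filter_upwards [e'.coeFn_compLp U, e'.coeFn_compLp V] with ω h1 h2
    simp only [map_sub, Pi.zero_apply]
    rw [← h1, ← h2, hw, sub_self]
  refine Lp.ext ?_
  filter_upwards [h0] with ω hω
  exact sub_eq_zero.1 hω

/-! ### Conditional expectation as projection onto `G_Y`. -/

namespace CenteredJointlyGaussian

variable {Ω E F : Type*} [mΩ : MeasurableSpace Ω] {μ : Measure Ω} [IsProbabilityMeasure μ]
  [NormedAddCommGroup E] [NormedSpace ℝ E] [CompleteSpace E] [TopologicalSpace.SeparableSpace E]
  [MeasurableSpace E] [BorelSpace E]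
  [NormedAddCommGroup F] [NormedSpace ℝ F] [CompleteSpace F] [TopologicalSpace.SeparableSpace F]
  [MeasurableSpace F] [BorelSpace F] {X : Ω → E} {Y : Ω → F}

/-- `X` as an element of `L²(μ; E)`. -/
noncomputable def X2 (h : CenteredJointlyGaussian X Y μ) : Lp E 2 μ := h.memLp_fst.toLp X

theorem compLp_X2 (h : CenteredJointlyGaussian X Y μ) (e' : StrongDual ℝ E) :
    e'.compLp h.X2 =ᵐ[μ] fun ω => e' (X ω) := by
  filter_upwards [e'.coeFn_compLp h.X2, h.memLp_fst.coeFn_toLp] with ω h1 h2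
  rw [h1, X2, h2]

theorem compLp_Y2 (h : CenteredJointlyGaussian X Y μ) (f' : StrongDual ℝ F) :
    f'.compLp h.Y2 =ᵐ[μ] fun ω => f' (Y ω) := by
  filter_upwards [f'.coeFn_compLp h.Y2, h.memLp_snd.coeFn_toLp] with ω h1 h2
  rw [h1, Y2, h2]

theorem weakSigma_le_comap : weakSigma Y ≤ MeasurableSpace.comap Y inferInstance := by
  refine iSup_le fun f' => ?_
  rw [← BorelSpace.measurable_eq (α := ℝ)]
  change MeasurableSpace.comap (f' ∘ Y) _ ≤ _
  rw [← MeasurableSpace.comap_comp]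
  exact MeasurableSpace.comap_mono f'.measurable.comap_le

theorem weakSigma_le (h : CenteredJointlyGaussian X Y μ) : weakSigma Y ≤ mΩ :=
  weakSigma_le_comap.trans h.measurable_snd.comap_le

theorem measurable_weakSigma (f' : StrongDual ℝ F) : Measurable[weakSigma Y] fun ω => f' (Y ω) := by
  refine Measurable.of_comap_le ?_
  rw [BorelSpace.measurable_eq (α := ℝ)]
  exact le_iSup (fun f' : StrongDual ℝ F =>
    MeasurableSpace.comap (fun ω => f' (Y ω)) (borel ℝ)) f'

/-- Measurability up to null sets for a sub-σ-algebra is a closed condition in `L²`, and each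
`f'(Y)` satisfies it. -/
theorem aestronglyMeasurable_of_mem (h : CenteredJointlyGaussian X Y μ) {p : Lp ℝ 2 μ}
    (hp : p ∈ gaussianHilbert h.Y2) : AEStronglyMeasurable[weakSigma Y] p μ :=
  gaussianHilbert_subset h.Y2 (isClosed_aestronglyMeasurable h.weakSigma_le)
    (fun f' => ⟨_, (measurable_weakSigma f').stronglyMeasurable, h.compLp_Y2 f'⟩) hp

/-- For `p = f'(Y)` this is the joint Gaussianity of `(X, Y)`; closedness of Gaussian laws passes it
to `L²` limits. -/
theorem hasGaussianLaw_add (h : CenteredJointlyGaussian X Y μ) (e' : StrongDual ℝ E)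
    {p : Lp ℝ 2 μ} (hp : p ∈ gaussianHilbert h.Y2) :
    HasGaussianLaw (e'.compLp h.X2 + p : Lp ℝ 2 μ) μ := by
  have := UniformSpace.secondCountable_of_separable E
  have := UniformSpace.secondCountable_of_separable F
  refine gaussianHilbert_subset h.Y2 (s := {p | HasGaussianLaw (e'.compLp h.X2 + p : Lp ℝ 2 μ) μ})
    (isClosed_hasGaussianLaw_L2.preimage (continuous_const.add continuous_id)) (fun f' => ?_) hp
  refine (h.jointlyGaussian.map_fun (e'.coprod f')).congr ?_
  filter_upwards [h.compLp_X2 e', h.compLp_Y2 f', Lp.coeFn_add (e'.compLp h.X2) (f'.compLp h.Y2)]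
    with ω h1 h2 h3
  refine Eq.trans ?_ h3.symm
  rw [Pi.add_apply, h1, h2, ContinuousLinearMap.coprod_apply]

/-- A functional `(s, y) ↦ a s + f' y` applied to the pair gives `(a e')(X) + (f'(Y) - a p)`, whose
second summand is again in `G_Y`, so `hasGaussianLaw_add` applies. -/
theorem hasGaussianLaw_prodMk (h : CenteredJointlyGaussian X Y μ) (e' : StrongDual ℝ E)
    {p : Lp ℝ 2 μ} (hp : p ∈ gaussianHilbert h.Y2) :
    HasGaussianLaw (fun ω => ((e'.compLp h.X2 - p : Lp ℝ 2 μ) ω, Y ω)) μ := by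
  have := UniformSpace.secondCountable_of_separable F
  have hm : AEMeasurable (fun ω => ((e'.compLp h.X2 - p : Lp ℝ 2 μ) ω, Y ω)) μ :=
    (Lp.aestronglyMeasurable _).aemeasurable.prodMk h.measurable_snd.aemeasurable
  refine ⟨isGaussian_of_isGaussian_map fun L => ?_⟩
  rw [AEMeasurable.map_map_of_aemeasurable L.measurable.aemeasurable hm]
  let a : ℝ := L (1, 0)
  let f' : StrongDual ℝ F := L.comp (.inr ℝ ℝ F)
  have hq : f'.compLp h.Y2 - a • p ∈ gaussianHilbert h.Y2 :=
    Submodule.sub_mem _ (compLp_mem_gaussianHilbert _ _) (Submodule.smul_mem _ _ hp)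
  refine ((h.hasGaussianLaw_add (a • e') hq).congr ?_).isGaussian_map
  rw [ContinuousLinearMap.smul_compLp]
  filter_upwards [h.compLp_Y2 f', Lp.coeFn_add (a • e'.compLp h.X2) (f'.compLp h.Y2 - a • p),
    Lp.coeFn_sub (f'.compLp h.Y2) (a • p), Lp.coeFn_smul a p, Lp.coeFn_smul a (e'.compLp h.X2),
    Lp.coeFn_sub (e'.compLp h.X2) p] with ω h1 h2 h3 h4 h5 h6
  have hL : ∀ (s : ℝ) (y : F), L (s, y) = a * s + f' y := fun s y => by
    have : ((s, y) : ℝ × F) = s • (1, 0) + (0, y) := by simp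
    rw [this, map_add, map_smul, smul_eq_mul, mul_comm]
    rfl
  rw [h2, Function.comp_apply, hL, h6, Pi.add_apply, Pi.sub_apply, h3, Pi.sub_apply, h4, h5, h1]
  simp only [Pi.smul_apply, smul_eq_mul]
  ring

theorem integral_dual_Y (h : CenteredJointlyGaussian X Y μ) (f' : StrongDual ℝ F) :
    ∫ ω, f' (Y ω) ∂μ = 0 := by
  rw [f'.integral_comp_comm (h.memLp_snd.integrable one_le_two), h.centered_snd, map_zero]

/-- The residual of the projection of `e'(X)` onto `G_Y` is independent of `Y`. -/
theorem indepFun_sub_starProjection (h : CenteredJointlyGaussian X Y μ) (e' : StrongDual ℝ E) :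
    IndepFun (e'.compLp h.X2 - (gaussianHilbert h.Y2).starProjection (e'.compLp h.X2) : Lp ℝ 2 μ)
      Y μ := by
  have := UniformSpace.secondCountable_of_separable F
  have hG := h.hasGaussianLaw_prodMk e'
    ((gaussianHilbert h.Y2).starProjection_apply_mem (e'.compLp h.X2))
  have ho := (gaussianHilbert h.Y2).sub_starProjection_mem_orthogonal (e'.compLp h.X2)
  set ζ : Lp ℝ 2 μ := e'.compLp h.X2 - (gaussianHilbert h.Y2).starProjection (e'.compLp h.X2)
  refine hG.indepFun_of_covariance_strongDual fun L f' => ?_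
  rw [covariance_eq_sub (hG.fst.map L).memLp_two (hG.snd.map f').memLp_two]
  have h0 : ∫ ω, (f' ∘ Y) ω ∂μ = 0 := h.integral_dual_Y f'
  -- A functional on `ℝ` is multiplication by `L 1`, so the covariance reduces to an inner product
  -- of `ζ` with an element of `G_Y`, to which `ζ` is orthogonal.
  have h1 : ∫ ω, ((L ∘ ζ) * (f' ∘ Y)) ω ∂μ = L 1 * inner ℝ (f'.compLp h.Y2) ζ := by
    rw [L2.inner_def, ← integral_const_mul]
    refine integral_congr_ae ?_
    filter_upwards [h.compLp_Y2 f'] with ω hω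
    have hL : L (ζ ω) = ζ ω * L 1 := by
      rw [← smul_eq_mul, ← map_smul, smul_eq_mul, mul_one]
    simp [hω, hL]
    ring
  rw [h0, h1, (Submodule.mem_orthogonal _ _).1 ho _ (compLp_mem_gaussianHilbert _ _)]
  simp

theorem integral_dual_X (h : CenteredJointlyGaussian X Y μ) (e' : StrongDual ℝ E) :
    ∫ ω, e' (X ω) ∂μ = 0 := by
  rw [e'.integral_comp_comm (h.memLp_fst.integrable one_le_two), h.centered_fst, map_zero]

theorem integral_of_mem (h : CenteredJointlyGaussian X Y μ) {p : Lp ℝ 2 μ}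
    (hp : p ∈ gaussianHilbert h.Y2) : ∫ ω, p ω ∂μ = 0 :=
  gaussianHilbert_subset h.Y2 (isClosed_eq continuous_integral_L2 continuous_const)
    (fun f' => (integral_congr_ae (h.compLp_Y2 f')).trans (h.integral_dual_Y f')) hp

/-- For jointly Gaussian variables the conditional expectation given `Y` is the orthogonal
projection onto the Gaussian Hilbert space of `Y`. -/
theorem compLp_Z2 (h : CenteredJointlyGaussian X Y μ) (e' : StrongDual ℝ E) :
    e'.compLp h.Z2 = (gaussianHilbert h.Y2).starProjection (e'.compLp h.X2) := by
  have hI := h.indepFun_sub_starProjection e'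
  have hp := (gaussianHilbert h.Y2).starProjection_apply_mem (e'.compLp h.X2)
  set p : Lp ℝ 2 μ := (gaussianHilbert h.Y2).starProjection (e'.compLp h.X2)
  set ζ : Lp ℝ 2 μ := e'.compLp h.X2 - p
  have hint : ∀ g : Lp ℝ 2 μ, Integrable g μ := fun g => (Lp.memLp g).integrable one_le_two
  have hζ0 : ∫ ω, ζ ω ∂μ = 0 := by
    rw [integral_congr_ae (Lp.coeFn_sub (e'.compLp h.X2) p)]
    simp only [Pi.sub_apply]
    rw [integral_sub (hint _) (hint _), integral_congr_ae (h.compLp_X2 e'), h.integral_dual_X,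
      h.integral_of_mem hp, sub_zero]
  -- Independence from `Y` passes to the sub-σ-algebra `weakSigma Y`, where conditioning returns the
  -- mean.
  have hζ : μ[ζ | weakSigma Y] =ᵐ[μ] fun _ => ∫ ω, ζ ω ∂μ :=
    condExp_indep_eq (Lp.stronglyMeasurable ζ).measurable.comap_le h.weakSigma_le
      (comap_measurable ζ).stronglyMeasurable
      (indep_of_indep_of_le_right hI weakSigma_le_comap)
  have hpc := condExp_of_aestronglyMeasurable' h.weakSigma_le (h.aestronglyMeasurable_of_mem hp)
    (hint p)
  have hX : e' ∘ X =ᵐ[μ] (ζ : Ω → ℝ) + p := by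
    filter_upwards [h.compLp_X2 e', Lp.coeFn_sub (e'.compLp h.X2) p] with ω h1 h2
    rw [Pi.add_apply, h2, Pi.sub_apply, h1, sub_add_cancel, Function.comp_apply]
  have hZ := e'.comp_condExp_comm (m := weakSigma Y) (h.memLp_fst.integrable one_le_two)
  refine Lp.ext ?_
  filter_upwards [e'.coeFn_compLp h.Z2, h.memLp_condExpGiven.coeFn_toLp, hZ,
    condExp_congr_ae (m := weakSigma Y) hX, condExp_add (hint ζ) (hint p) (weakSigma Y), hζ, hpc]
    with ω h1 h2 h3 h4 h5 h6 h7
  rw [h1, Z2, h2, condExpGiven]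
  change (e' ∘ _) ω = _
  rw [h3, h4, h5, Pi.add_apply, h6, h7, hζ0, zero_add]

end CenteredJointlyGaussian

/-! ### Extension of `M_W` and identification of `MY`. -/

theorem mainTheorem8 {Ω : Type*} [MeasurableSpace Ω] (μ : Measure Ω) [IsProbabilityMeasure μ]
    {E : Type*} [NormedAddCommGroup E] [NormedSpace ℝ E] [CompleteSpace E]
    [TopologicalSpace.SeparableSpace E] [MeasurableSpace E] [BorelSpace E]
    {F : Type*} [NormedAddCommGroup F] [NormedSpace ℝ F] [CompleteSpace F]
    [TopologicalSpace.SeparableSpace F] [MeasurableSpace F] [BorelSpace F]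
    (X : Ω → E) (Y : Ω → F) (h : CenteredJointlyGaussian X Y μ)
    (hdense : Dense (wienerSubmodule h.Y2 : Set F))
    (hbound : ∃ C : ℝ, 0 < C ∧ ∀ w : WienerSpace h.Y2,
      ‖WienerSpace.incl h.Z2 (h.M_W w)‖ ≤ C * ‖WienerSpace.incl h.Y2 w‖) :
    ∃ M : F →L[ℝ] E,
      (∀ᵐ ω ∂μ, M (Y ω) = condExpGiven X Y μ ω) ∧
      ∀ w : WienerSpace h.Y2,
        M (WienerSpace.incl h.Y2 w) = WienerSpace.incl h.Z2 (h.M_W w) := by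
  have := UniformSpace.secondCountable_of_separable E
  obtain ⟨C, -, hC⟩ := hbound
  let T : WienerSpace h.Y2 →ₗ[ℝ] E := WienerSpace.incl h.Z2 ∘ₗ h.M_W.toLinearMap
  -- The density and the bound are not needed to write this extension; they enter through
  -- `LinearMap.extendOfNorm_eq`, which makes it agree with `T` on `W_Y`.
  let M : F →L[ℝ] E := T.extendOfNorm (WienerSpace.incl h.Y2)
  have hd : DenseRange (WienerSpace.incl h.Y2) := hdense.denseRange_val
  have hM : ∀ w, M (WienerSpace.incl h.Y2 w) = WienerSpace.incl h.Z2 (h.M_W w) :=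
    LinearMap.extendOfNorm_eq hd ⟨C, hC⟩
  refine ⟨M, ?_, hM⟩
  have hMY : M.compLp h.Y2 = h.Z2 := by
    refine eq_of_bochnerPairing_eq _ _ (gaussianHilbert h.Y2) (fun e' => ?_) (fun e' => ?_)
      fun g hg => ?_
    · rw [compLp_compLp]
      exact compLp_mem_gaussianHilbert _ _
    · rw [h.compLp_Z2]
      exact (gaussianHilbert h.Y2).starProjection_apply_mem _
    · rw [bochnerPairing_compLp]
      exact (hM (WienerSpace.V h.Y2 ⟨g, hg⟩)).trans (incl_wienerM_V h.Y2 h.Z2 ⟨g, hg⟩)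
  filter_upwards [M.coeFn_compLp h.Y2, h.memLp_snd.coeFn_toLp, h.memLp_condExpGiven.coeFn_toLp]
    with ω h1 h2 h3
  rw [← h2, ← h3]
  change M (h.Y2 ω) = h.Z2 ω
  rw [← h1, hMY]
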